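/- Call $A\in\mathbb{Z}^{m\times n}$ \emph{$r$-row affine TU decomposable} if there are matrices $U\in\mathbb{Z}^{m\times r}$ and $W\in\{0,\pm1\}^{r\times n}$ such that, with $\tilde A:=A-UW$, the stacked matrix $\begin{bmatrix}\tilde A\\ W\end{bmatrix}$ is totally unimodular; the \emph{affine TU-dimension} of $A$ is the minimum such $r\ge 0$. Theorem. Let $m\ge 0$ and $k\ge 0$ be fixed integers. Then there is an algorithm which, given $n$ and a matrix $A\in\mathbb{Z}^{m\times n}$ as input, decides whether the affine TU-dimension of $A$ equals $k$, in time polynomial in the binary encoding length of $A$. That is, some Turing machine (which may depend on $m$ and $k$) answers this question for every $n$ and every $A\in\mathbb{Z}^{m\times n}$, and the number of its steps is bounded by a polynomial (which may depend on $m$ and $k$) in the length of the input, the entries of $A$ being written in binary. -/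

import Mathlib

/-- `A` admits an `r`-row affine TU decomposition: there are an integer matrix `U` and a
`{0, ±1}`-matrix `W` with `r` rows such that, for the matrix `B := A - U * W` (the only one with
`A = B + U * W`), the stacked matrix `[B; W]` is totally unimodular. -/
def AdmitsAffineTUDecomposition {m n : ℕ} (A : Matrix (Fin m) (Fin n) ℤ) (r : ℕ) : Prop :=
  ∃ (U : Matrix (Fin m) (Fin r) ℤ) (W : Matrix (Fin r) (Fin n) ℤ),
    (∀ i j, W i j = 0 ∨ W i j = 1 ∨ W i j = -1) ∧
      (Matrix.fromRows (A - U * W) W).IsTotallyUnimodular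

/-- `A` has affine TU-dimension `k`: `k` is the least number of rows of an affine TU
decomposition of `A`. -/
def HasAffineTUDimension {m n : ℕ} (A : Matrix (Fin m) (Fin n) ℤ) (k : ℕ) : Prop :=
  IsLeast {r : ℕ | AdmitsAffineTUDecomposition A r} k

/-- The finite alphabet in which integer matrices are written. -/
inductive MatrixSymbol : Type
  | minus
  | bit (b : Bool)
  | endEntry
  | endColumn

/-- An integer in sign-magnitude binary notation, least significant bit first, followed by an
end marker. -/
def encodeEntry (z : ℤ) : List MatrixSymbol :=
  (if z < 0 then [MatrixSymbol.minus] else []) ++ z.natAbs.bits.map MatrixSymbol.bit ++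
    [MatrixSymbol.endEntry]

/-- A vector of integers: its entries one after the other, followed by an end marker. -/
def encodeColumn {m : ℕ} (v : Fin m → ℤ) : List MatrixSymbol :=
  (List.ofFn fun i => encodeEntry (v i)).flatten ++ [MatrixSymbol.endColumn]

/-- An integer matrix with `m` rows and any number of columns, written column by column.
The length of this word is the binary encoding size of the matrix (up to a constant factor). -/
def encodeMatrix {m : ℕ} (A : Σ n : ℕ, Matrix (Fin m) (Fin n) ℤ) : List MatrixSymbol :=
  (List.ofFn fun j : Fin A.1 => encodeColumn fun i => A.2 i j).flatten

open Classical in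
/-- The property `P` of instances in `α`, presented to the machine as words through `enc`, is
decided in polynomial time: some Turing machine, started on `enc a`, halts with the truth value of
`P a` as its output after at most `p (length of enc a)` steps, for a fixed polynomial `p`. -/
def DecidableInPolyTime {α S : Type} (enc : α → List S) (P : α → Prop) : Prop :=
  Nonempty (Turing.TM2ComputableInPolyTime enc Computability.encodeBool fun a => decide (P a))

/-! An `r`-row decomposition writes every column of `A` as `c + U w`, where `(c, w)` is a column of
a totally unimodular matrix and so has entries `0, ±1`. Hence `A` has at most `3 ^ (m + r)` distinct
columns (`card_columns_le`), and repeating columns or adding zero columns changes nothing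
(`of_columns`). Put `N = 3 ^ (m + k)`. An input with more than `N` distinct columns cannot have
dimension `k`; any other input may be replaced by a matrix with exactly `N` columns, and then only
the size of the entries is unbounded.

In this fixed format, the matrices with an `r`-row decomposition form a finite union, over the
totally unimodular sign matrices `[C; W]`, of cosets of the groups `{U W}`. A coset of a group `L`
is recognized by a finite automaton that reads all entries in parallel, least significant digit
first: its quotient by a digit vector is empty or a coset of `{y | 2 y ∈ L}`, the chain `{y | 2 ^ n
y ∈ L}` stabilizes, and representatives can be kept bounded (`isBinaryRecognizable_coset`).
Recognizable sets are closed under Boolean operations, so the matrices of dimension exactly `k` are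
recognizable too.

A multi-stack machine keeps the distinct columns in `N` slots, compares each new column with them,
and finally runs the automaton on the slots (`reaches_insert`, `reaches_end`). Its step count is
quadratic in the input length, and `decidableInPolyTime` turns it into a Turing machine. -/

/-! ### Binary recognizable sets -/

/-- A set of integer vectors is binary recognizable if it belongs to a finite family of sets that is
closed under the quotients `{y | 2 y + b ∈ S}` by digit vectors `b` with entries in `{0, ±1}`. -/
def IsBinaryRecognizable {ι : Type*} (T : Set (ι → ℤ)) : Prop :=
  ∃ F : Set (Set (ι → ℤ)), F.Finite ∧ T ∈ F ∧
    ∀ S ∈ F, ∀ b : ι → ℤ, (∀ i, |b i| ≤ 1) → {y | (2 : ℤ) • y + b ∈ S} ∈ F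

namespace IsBinaryRecognizable

variable {ι : Type*} {S T : Set (ι → ℤ)}

/-- Quotients are preimages under `y ↦ 2 y + b`, so they commute with Boolean operations, which can
therefore be applied memberwise to the finite families. -/
theorem compl (hT : IsBinaryRecognizable T) : IsBinaryRecognizable Tᶜ := by
  obtain ⟨F, hF, hTF, hq⟩ := hT
  refine ⟨(·ᶜ) '' F, hF.image _, ⟨T, hTF, rfl⟩, ?_⟩
  rintro _ ⟨S, hS, rfl⟩ b hb
  exact ⟨_, hq S hS b hb, rfl⟩

theorem union (hS : IsBinaryRecognizable S) (hT : IsBinaryRecognizable T) :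
    IsBinaryRecognizable (S ∪ T) := by
  obtain ⟨F, hF, hSF, hqF⟩ := hS
  obtain ⟨G, hG, hTG, hqG⟩ := hT
  refine ⟨Set.image2 (· ∪ ·) F G, hF.image2 _ hG, ⟨S, hSF, T, hTG, rfl⟩, ?_⟩
  rintro _ ⟨S, hS, T, hT, rfl⟩ b hb
  exact ⟨_, hqF S hS b hb, _, hqG T hT b hb, rfl⟩

theorem inter (hS : IsBinaryRecognizable S) (hT : IsBinaryRecognizable T) :
    IsBinaryRecognizable (S ∩ T) := by
  simpa [Set.compl_union] using (hS.compl.union hT.compl).compl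

theorem empty : IsBinaryRecognizable (∅ : Set (ι → ℤ)) :=
  ⟨{∅}, Set.finite_singleton _, rfl, by rintro _ rfl b -; simp⟩

theorem biUnion {κ : Type*} {s : Set κ} (hs : s.Finite) {f : κ → Set (ι → ℤ)}
    (hf : ∀ x ∈ s, IsBinaryRecognizable (f x)) : IsBinaryRecognizable (⋃ x ∈ s, f x) := by
  induction s, hs using Set.Finite.induction_on with
  | empty => simpa using empty
  | insert _ _ ih =>
    rw [Set.biUnion_insert]
    exact (hf _ (Set.mem_insert _ _)).union (ih fun x hx => hf x (Set.mem_insert_of_mem _ hx))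

end IsBinaryRecognizable

/-! ### Cosets of lattices -/

/-- Reducing the coefficients of a combination of generators modulo 2 leaves one of finitely many
`0/1` combinations. -/
theorem Submodule.FG.exists_finite_mod_two {M : Type*} [AddCommGroup M] {L : Submodule ℤ M}
    (hL : L.FG) : ∃ R : Set M, R.Finite ∧ ∀ l ∈ L, ∃ r ∈ R, ∃ l' ∈ L, l = r + (2 : ℤ) • l' := by
  classical
  obtain ⟨t, rfl⟩ := hL
  refine ⟨(fun e : t → Fin 2 => ∑ x, ((e x : ℕ) : ℤ) • (x : M)) '' Set.univ,
    Set.finite_univ.image _, fun l hl => ?_⟩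
  obtain ⟨a, rfl⟩ := Submodule.mem_span_finset'.1 hl
  refine ⟨_, ⟨fun x => ⟨(a x % 2).toNat, by omega⟩, trivial, rfl⟩, ∑ x : t, (a x / 2) • (x : M),
    Submodule.sum_mem _ fun x _ => Submodule.smul_mem _ _ (Submodule.subset_span x.2), ?_⟩
  rw [Finset.smul_sum, ← Finset.sum_add_distrib]
  refine Finset.sum_congr rfl fun x _ => ?_
  rw [smul_smul, ← add_smul]
  congr 1
  have : ((a x % 2).toNat : ℤ) = a x % 2 := Int.toNat_of_nonneg (by omega)
  simp only [this]
  omega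

/-- The submodule of the elements `y` with `2 ^ n • y ∈ L`. -/
def Submodule.divTwoPow {M : Type*} [AddCommGroup M] (L : Submodule ℤ M) : ℕ →o Submodule ℤ M where
  toFun n := L.comap (LinearMap.lsmul ℤ M (2 ^ n))
  monotone' := monotone_nat_of_le_succ fun n y hy => by
    simp only [Submodule.mem_comap, LinearMap.lsmul_apply] at hy ⊢
    rw [pow_succ', mul_smul]
    exact L.smul_mem _ hy

theorem Submodule.mem_divTwoPow {M : Type*} [AddCommGroup M] {L : Submodule ℤ M} {n : ℕ} {y : M} :
    y ∈ L.divTwoPow n ↔ (2 ^ n : ℤ) • y ∈ L := Iff.rfl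

theorem isBinaryRecognizable_coset {ι : Type*} [Finite ι] (L : Submodule ℤ (ι → ℤ)) (v : ι → ℤ) :
    IsBinaryRecognizable {y | y - v ∈ L} := by
  classical
  have := Fintype.ofFinite ι
  obtain ⟨n₀, hn₀⟩ := monotone_stabilizes_iff_noetherian.2
    (inferInstance : IsNoetherian ℤ (ι → ℤ)) L.divTwoPow
  have hrange : (Set.range L.divTwoPow).Finite := by
    refine ((Set.finite_Iic n₀).image L.divTwoPow).subset ?_
    rintro _ ⟨n, rfl⟩
    rcases le_total n n₀ with h | h
    · exact ⟨n, h, rfl⟩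
    · exact ⟨n₀, Set.mem_Iic.2 le_rfl, hn₀ n h⟩
  have hdigits (M : Submodule ℤ (ι → ℤ)) := (IsNoetherian.noetherian M).exists_finite_mod_two
  choose R hRfin hR using hdigits
  -- `C` bounds the residues of all groups in the chain, finitely many in total, and the initial
  -- representative `v`.
  obtain ⟨C, hC⟩ : ∃ C : ℤ, ∀ r ∈ (⋃ M ∈ Set.range L.divTwoPow, R M) ∪ {v}, ∀ i, |r i| ≤ C := by
    have hfin : ((⋃ M ∈ Set.range L.divTwoPow, R M) ∪ {v}).Finite :=
      (hrange.biUnion fun M _ => hRfin M).union (Set.finite_singleton v)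
    obtain ⟨C, hC⟩ := (hfin.image fun r => ∑ i, |r i|).bddAbove
    refine ⟨C, fun r hr i => le_trans ?_ (hC ⟨r, hr, rfl⟩)⟩
    exact Finset.single_le_sum (f := fun i => |r i|) (fun _ _ => abs_nonneg _) (Finset.mem_univ i)
  refine ⟨insert ∅ (Set.image2 (fun (M : Submodule ℤ (ι → ℤ)) w => {y | y - w ∈ M})
    (Set.range L.divTwoPow) (Set.Icc (fun _ => -(C + 1)) fun _ => C + 1)),
    (hrange.image2 _ (Set.finite_Icc _ _)).insert _, Or.inr ⟨L, ⟨0, ?_⟩, v, ?_, rfl⟩, ?_⟩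
  · ext y
    simp [Submodule.mem_divTwoPow]
  · have hv := hC v (Or.inr rfl)
    exact ⟨fun i => by have := abs_le.1 (hv i); simp only; omega,
      fun i => by have := abs_le.1 (hv i); simp only; omega⟩
  rintro S (rfl | ⟨_, ⟨n, rfl⟩, w, hw, rfl⟩) b hb
  · left
    simp
  by_cases hne : ∃ y, (2 : ℤ) • y + b - w ∈ L.divTwoPow n
  swap
  · left
    push Not at hne
    exact Set.eq_empty_of_forall_notMem hne
  right
  obtain ⟨y, hy⟩ := hne
  obtain ⟨r, hr, l, hl, h⟩ := hR _ _ hy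
  -- From `2 y + b - w = r + 2 l` follows `2 (y - l) = r + w - b`, with entries at most `C + (C + 1)
  -- + 1` in absolute value. So the new representative `y - l` again obeys the bound `C + 1`.
  refine ⟨_, ⟨n + 1, rfl⟩, y - l, ?_, ?_⟩
  · have key : ∀ i, |(y - l) i| ≤ C + 1 := fun i => by
      have h1 : 2 * y i + b i - w i = r i + 2 * l i := by simpa using congrFun h i
      have h2 := abs_le.1 (hb i)
      have h3 := hw.1 i
      have h4 := hw.2 i
      have h5 := abs_le.1 (hC r (Or.inl (Set.mem_biUnion ⟨n, rfl⟩ hr)) i)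
      simp only at h3 h4
      rw [Pi.sub_apply, abs_le]
      omega
    exact ⟨fun i => (abs_le.1 (key i)).1, fun i => (abs_le.1 (key i)).2⟩
  · ext x
    simp only [Set.mem_ofPred_eq]
    have e : (2 : ℤ) • x + b - w = (2 : ℤ) • (x - y) + ((2 : ℤ) • y + b - w) := by
      rw [smul_sub]; abel
    rw [e, Submodule.add_mem_iff_left _ hy, Submodule.mem_divTwoPow, Submodule.mem_divTwoPow,
      smul_smul, ← pow_succ, ← Submodule.mem_divTwoPow, ← Submodule.mem_divTwoPow]
    have e' : x - (y - l) = x - y + l := by abel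
    rw [e', Submodule.add_mem_iff_left]
    exact L.divTwoPow.monotone n.le_succ hl

/-! ### Affine TU decompositions and the columns of a matrix -/

open Matrix

namespace AdmitsAffineTUDecomposition

/-- Passing to a matrix all of whose columns are zero or columns of `A`. -/
theorem of_columns {m n p r : ℕ} {A : Matrix (Fin m) (Fin n) ℤ} {B : Matrix (Fin m) (Fin p) ℤ}
    (hA : AdmitsAffineTUDecomposition A r)
    (hB : ∀ j, (∀ i, B i j = 0) ∨ ∃ j', ∀ i, B i j = A i j') :
    AdmitsAffineTUDecomposition B r := by
  obtain ⟨U, W, hW, hTU⟩ := hA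
  -- After a zero column is adjoined to `A`, every column of `B` is a column of the enlarged matrix.
  -- Total unimodularity survives both the adjunction and the reindexing `g`, which need not be
  -- injective.
  have hB' : ∀ j, ∃ o : Fin n ⊕ Fin 1, ∀ i, B i j = fromCols A (replicateCol (Fin 1) 0) i o := by
    intro j
    rcases hB j with h | ⟨j', h⟩
    exacts [⟨.inr 0, by simpa using h⟩, ⟨.inl j', by simpa using h⟩]
  choose g hg using hB'
  let W₀ : Matrix (Fin r) (Fin n ⊕ Fin 1) ℤ := fromCols W (replicateCol (Fin 1) 0)
  refine ⟨U, W₀.submatrix id g, fun i j => ?_, ?_⟩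
  · simp only [submatrix_apply, id]
    cases g j with
    | inl j' => exact hW i j'
    | inr j' => left; simp [W₀]
  · rw [← fromCols_replicateCol0_isTotallyUnimodular_iff (n' := Fin 1)] at hTU
    convert hTU.submatrix id g using 1
    ext i j
    have hj := hg j
    rcases i with i | i
    · simp only [fromRows_apply_inl, Matrix.sub_apply, mul_apply, submatrix_apply, id, hj i]
      cases g j <;> simp [W₀, mul_apply]
    · simp only [fromRows_apply_inr, submatrix_apply, id]
      cases g j <;> simp [W₀]

/-- For fixed `U`, a column of `A` is a function of the corresponding column of the stacked matrix,
a sign vector of length `m + r`. -/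
theorem card_columns_le {m n r : ℕ} {A : Matrix (Fin m) (Fin n) ℤ}
    (hA : AdmitsAffineTUDecomposition A r) :
    (Finset.univ.image fun j => A.col j).card ≤ 3 ^ (m + r) := by
  classical
  obtain ⟨U, W, -, hTU⟩ := hA
  choose c hc using fun i j => hTU.apply i j
  have hfac : ∀ j, A.col j = fun i => ((c (.inl i) j : SignType) : ℤ) +
      ∑ l, U i l * ((c (.inr l) j : SignType) : ℤ) := by
    intro j
    ext i
    simp [hc, mul_apply]
  have hsub : (Finset.univ.image fun j => A.col j) ⊆
      Finset.univ.image fun (s : Fin m ⊕ Fin r → SignType) (i : Fin m) =>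
        (s (.inl i) : ℤ) + ∑ l, U i l * (s (.inr l) : ℤ) := by
    intro x hx
    obtain ⟨j, -, rfl⟩ := Finset.mem_image.1 hx
    exact Finset.mem_image.2 ⟨fun i => c i j, Finset.mem_univ _, (hfac j).symm⟩
  refine (Finset.card_le_card hsub).trans (Finset.card_image_le.trans ?_)
  have h3 : Fintype.card SignType = 3 := rfl
  simp [Finset.card_univ, h3]

end AdmitsAffineTUDecomposition

/-- The linear map `U ↦ U W`, with the entries of the product listed by column and row. -/
def mulRightFlat {m n r : ℕ} (W : Matrix (Fin r) (Fin n) ℤ) :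
    Matrix (Fin m) (Fin r) ℤ →ₗ[ℤ] (Fin n × Fin m → ℤ) where
  toFun U x := (U * W) x.2 x.1
  map_add' U V := by ext x; simp [Matrix.add_mul]
  map_smul' c U := by ext x; simp

/-- A totally unimodular matrix has entries in `SignType`, so there are finitely many candidates for
the stacked matrix; each contributes one coset of the range of `U ↦ U W`. -/
theorem isBinaryRecognizable_admitsAffineTUDecomposition (m n r : ℕ) :
    IsBinaryRecognizable {y : Fin n × Fin m → ℤ |
      AdmitsAffineTUDecomposition (Matrix.of fun i j => y (j, i)) r} := by
  classical
  let s : Set (Matrix (Fin m ⊕ Fin r) (Fin n) SignType) :=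
    {C | (C.map fun x => (x : ℤ)).IsTotallyUnimodular}
  have key := IsBinaryRecognizable.biUnion (s := s) (Set.toFinite s)
    (f := fun C => {y : Fin n × Fin m → ℤ | y - (fun x => (C (.inl x.2) x.1 : ℤ)) ∈
      LinearMap.range (mulRightFlat (m := m) (Matrix.of fun i j => (C (.inr i) j : ℤ)))})
    fun C _ => isBinaryRecognizable_coset _ _
  convert key using 1
  ext y
  simp only [Set.mem_iUnion, Set.mem_ofPred_eq, LinearMap.mem_range]
  constructor
  · rintro ⟨U, W, -, hTU⟩
    choose c hc using fun i j => hTU.apply i j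
    have hmap : (Matrix.of c).map (fun x => (x : ℤ)) =
        fromRows (Matrix.of (fun i j => y (j, i)) - U * W) W := by
      ext i j; simp [hc]
    refine ⟨Matrix.of c, by rwa [Set.mem_ofPred_eq, hmap], U, ?_⟩
    have hW : (Matrix.of fun i j => ((Matrix.of c (.inr i) j : SignType) : ℤ)) = W := by
      ext i j; simp [hc]
    ext x
    rw [hW]
    simp [mulRightFlat, hc]
  · rintro ⟨C, hC, U, hU⟩
    refine ⟨U, Matrix.of fun i j => (C (.inr i) j : ℤ), fun i j => ?_, ?_⟩
    · simp only [of_apply]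
      cases C (.inr i) j <;> simp
    · refine (congrArg IsTotallyUnimodular ?_).mp hC
      ext i j
      rcases i with i | i
      · have := congrFun hU (j, i)
        simp only [mulRightFlat, LinearMap.coe_mk, AddHom.coe_mk, Pi.sub_apply] at this
        simp [this]
      · simp

theorem hasAffineTUDimension_iff {m n k : ℕ} {A : Matrix (Fin m) (Fin n) ℤ} :
    HasAffineTUDimension A k ↔ AdmitsAffineTUDecomposition A k ∧
      ∀ r < k, ¬ AdmitsAffineTUDecomposition A r := by
  refine and_congr_right fun _ => ⟨fun h r hr hA => ?_, fun h r hA => ?_⟩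
  · exact absurd (h hA) (by omega)
  · by_contra hlt
    exact h r (by omega) hA

theorem HasAffineTUDimension.congr_columns {m n p k : ℕ} {A : Matrix (Fin m) (Fin n) ℤ}
    {B : Matrix (Fin m) (Fin p) ℤ} (hB : ∀ j, (∀ i, B i j = 0) ∨ ∃ j', ∀ i, B i j = A i j')
    (hA : ∀ j, (∀ i, A i j = 0) ∨ ∃ j', ∀ i, A i j = B i j') :
    HasAffineTUDimension A k ↔ HasAffineTUDimension B k := by
  have h (r : ℕ) : AdmitsAffineTUDecomposition A r ↔ AdmitsAffineTUDecomposition B r :=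
    ⟨fun h => h.of_columns hB, fun h => h.of_columns hA⟩
  simp only [hasAffineTUDimension_iff, h]

theorem isBinaryRecognizable_hasAffineTUDimension (m n k : ℕ) :
    IsBinaryRecognizable {y : Fin n × Fin m → ℤ |
      HasAffineTUDimension (Matrix.of fun i j => y (j, i)) k} := by
  have h := (isBinaryRecognizable_admitsAffineTUDecomposition m n k).inter
    (IsBinaryRecognizable.biUnion (Set.finite_Iio k) fun r _ =>
      isBinaryRecognizable_admitsAffineTUDecomposition m n r).compl
  convert h using 1
  ext y
  simp [hasAffineTUDimension_iff]

/-! ### Multi-stack machines -/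

/-- One move of a multi-stack machine: the next state, whether to consume an input symbol, which
work stacks to pop, and what to push on them afterwards. -/
structure StackMove (X Q : Type) where
  state : Q
  consume : Bool
  pop : X → Bool
  push : X → Option Bool

/-- A machine that reads a word over `I` and has stacks of bits indexed by `X`; in one step
it inspects the tops of all stacks and halts with an answer or makes a move. -/
structure StackMachine (I X Q : Type) where
  start : Q
  next : Q → Option I → (X → Option Bool) → Bool ⊕ StackMove X Q

/-- A configuration of a multi-stack machine. -/
@[ext]
structure StackConfig (I X Q : Type) where
  state : Q
  input : List I
  work : X → List Bool

namespace StackMachine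

variable {I X Q : Type} (M : StackMachine I X Q)

/-- The effect of a move on a configuration. -/
def applyMove (c : StackConfig I X Q) (a : StackMove X Q) : StackConfig I X Q where
  state := a.state
  input := if a.consume then c.input.tail else c.input
  work x := (a.push x).toList ++ if a.pop x then (c.work x).tail else c.work x

/-- What the machine does in a configuration. -/
def action (c : StackConfig I X Q) : Bool ⊕ StackMove X Q :=
  M.next c.state c.input.head? fun x => (c.work x).head?

/-- `M.ReachesWithin n c c'`: starting in `c`, the machine is in `c'` after at most `n` steps. -/
inductive ReachesWithin : ℕ → StackConfig I X Q → StackConfig I X Q → Prop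
  | refl (n : ℕ) (c : StackConfig I X Q) : ReachesWithin n c c
  | step {n : ℕ} {c c' : StackConfig I X Q} {a : StackMove X Q} (h : M.action c = .inr a)
      (h' : ReachesWithin n (applyMove c a) c') : ReachesWithin (n + 1) c c'

variable {M}

theorem ReachesWithin.mono {n n' : ℕ} {c c' : StackConfig I X Q} (h : M.ReachesWithin n c c')
    (hn : n ≤ n') : M.ReachesWithin n' c c' := by
  induction h generalizing n' with
  | refl => exact .refl _ _
  | step h _ ih =>
    obtain ⟨k, rfl⟩ : ∃ k, n' = k + 1 := ⟨n' - 1, by omega⟩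
    exact .step h (ih (by omega))

theorem ReachesWithin.trans {n n' : ℕ} {c c' c'' : StackConfig I X Q}
    (h : M.ReachesWithin n c c') (h' : M.ReachesWithin n' c' c'') :
    M.ReachesWithin (n + n') c c'' := by
  induction h with
  | refl => exact h'.mono (by omega)
  | step h _ ih =>
    rw [Nat.add_right_comm]
    exact .step h (ih h')

theorem ReachesWithin.congr {n : ℕ} {c c' d d' : StackConfig I X Q} (h : M.ReachesWithin n c c')
    (hd : d = c) (hd' : d' = c') : M.ReachesWithin n d d' :=
  hd ▸ hd' ▸ h

theorem ReachesWithin.single {c c' : StackConfig I X Q} {a : StackMove X Q}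
    (h : M.action c = .inr a) (h' : applyMove c a = c') : M.ReachesWithin 1 c c' :=
  .step h (h' ▸ .refl _ _)

variable (M)

/-! ### Translation into Turing machines -/

section Compile

open Turing TM2 TM2.Stmt

/-- The alphabets of the input, output and work stacks. -/
abbrev Alphabet (I X : Type) : Bool ⊕ X → Type
  | .inl false => I
  | .inl true => Bool
  | .inr _ => Bool

/-- Internal states of the compiled machine: a state together with the symbols just seen. -/
abbrev Memory (I X Q : Type) : Type := Q × Option I × (X → Option Bool)

variable [DecidableEq X]

/-- Look at the tops of the listed work stacks. -/
def readStmt (l : List X) (q : Stmt (Alphabet I X) Unit (Memory I X Q)) :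
    Stmt (Alphabet I X) Unit (Memory I X Q) :=
  l.foldr (fun x q => peek (.inr x) (fun s h => (s.1, s.2.1, Function.update s.2.2 x h)) q) q

/-- Pop the listed work stacks that are selected by `f`. -/
def popStmt (f : Memory I X Q → X → Bool) (l : List X)
    (q : Stmt (Alphabet I X) Unit (Memory I X Q)) : Stmt (Alphabet I X) Unit (Memory I X Q) :=
  l.foldr (fun x q => branch (fun s => f s x) (pop (.inr x) (fun s _ => s) q) q) q

/-- Push the symbols given by `f` on the listed work stacks. -/
def pushStmt (f : Memory I X Q → X → Option Bool) (l : List X)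
    (q : Stmt (Alphabet I X) Unit (Memory I X Q)) : Stmt (Alphabet I X) Unit (Memory I X Q) :=
  l.foldr (fun x q => branch (fun s => (f s x).isSome)
    (push (.inr x) (fun s => ((f s x).getD false : Bool)) q) q) q

/-- The contents of all stacks. -/
def stackContents (u : List I) (S : X → List Bool) : ∀ k, List (Alphabet I X k)
  | .inl false => u
  | .inl true => []
  | .inr x => S x

theorem update_stackContents_work (u : List I) (S : X → List Bool) (x : X) (w : List Bool) :
    Function.update (stackContents u S) (.inr x) w = stackContents u (Function.update S x w) := by
  funext k
  rcases k with (_ | _) | y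
  · simp [stackContents]
  · simp [stackContents]
  · by_cases h : y = x
    · subst h
      simp [stackContents]
    · rw [Function.update_of_ne (by simpa using h)]
      simp [stackContents, Function.update_of_ne h]

theorem update_stackContents_input (u w : List I) (S : X → List Bool) :
    Function.update (stackContents u S) (.inl false) w = stackContents w S := by
  funext k
  rcases k with (_ | _) | y <;> simp [stackContents]

theorem stepAux_readStmt (l : List X) (q : Stmt (Alphabet I X) Unit (Memory I X Q))
    (s : Memory I X Q) (u : List I) (S : X → List Bool) :
    stepAux (readStmt l q) s (stackContents u S) =
      stepAux q (s.1, s.2.1, fun x => if x ∈ l then (S x).head? else s.2.2 x)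
        (stackContents u S) := by
  induction l generalizing s with
  | nil => simp [readStmt]
  | cons x l ih =>
    have e : readStmt (x :: l) q = peek (.inr x)
      (fun s h => (s.1, s.2.1, Function.update s.2.2 x h)) (readStmt l q) := rfl
    rw [e, stepAux, ih]
    congr 3
    funext y
    by_cases hy : y = x
    · subst hy
      by_cases hl : y ∈ l <;> simp [hl, stackContents]
    · simp [hy]

theorem stepAux_popStmt (f : Memory I X Q → X → Bool) {l : List X} (hl : l.Nodup)
    (q : Stmt (Alphabet I X) Unit (Memory I X Q))
    (s : Memory I X Q) (u : List I) (S : X → List Bool) :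
    stepAux (popStmt f l q) s (stackContents u S) =
      stepAux q s (stackContents u fun x => if x ∈ l ∧ f s x then (S x).tail else S x) := by
  induction l generalizing S with
  | nil => simp [popStmt]
  | cons x l ih =>
    have e : popStmt f (x :: l) q = branch (fun s => f s x)
      (pop (.inr x) (fun s _ => s) (popStmt f l q)) (popStmt f l q) := rfl
    rw [List.nodup_cons] at hl
    rw [e, stepAux]
    cases hx : f s x
    · rw [cond_false, ih hl.2]
      congr 2
      funext y
      by_cases hy : y = x
      · subst hy; simp [hx]
      · simp [hy]
    · have e' : (stackContents u S (Sum.inr x)).tail = (S x).tail := rfl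
      rw [cond_true, stepAux, e', update_stackContents_work, ih hl.2]
      congr 2
      funext y
      by_cases hy : y = x
      · subst hy; simp [hx, hl.1]
      · simp [hy]

theorem stepAux_pushStmt (f : Memory I X Q → X → Option Bool) {l : List X} (hl : l.Nodup)
    (q : Stmt (Alphabet I X) Unit (Memory I X Q))
    (s : Memory I X Q) (u : List I) (S : X → List Bool) :
    stepAux (pushStmt f l q) s (stackContents u S) =
      stepAux q s (stackContents u fun x => if x ∈ l then (f s x).toList ++ S x else S x) := by
  induction l generalizing S with
  | nil => simp [pushStmt]
  | cons x l ih =>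
    have e : pushStmt f (x :: l) q = branch (fun s => (f s x).isSome)
      (push (.inr x) (fun s => ((f s x).getD false : Bool)) (pushStmt f l q))
        (pushStmt f l q) := rfl
    rw [List.nodup_cons] at hl
    rw [e, stepAux]
    cases hx : f s x with
    | none =>
      rw [Option.isSome_none, cond_false, ih hl.2]
      congr 2
      funext y
      by_cases hy : y = x
      · subst hy; simp [hx]
      · simp [hy]
    | some b =>
      have e' : (((f s x).getD false : Bool) :: stackContents u S (Sum.inr x) : List Bool) =
        b :: S x := by rw [hx]; rfl
      rw [Option.isSome_some, cond_true, stepAux]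
      erw [e', update_stackContents_work, ih hl.2]
      congr 2
      funext y
      by_cases hy : y = x
      · subst hy; simp [hx, hl.1]
      · simp [hy]

variable [Fintype X]

/-- The move that the machine chooses after having seen the tops of the stacks. -/
def chosen (s : Memory I X Q) : Bool ⊕ StackMove X Q := M.next s.1 s.2.1 s.2.2

/-- The chosen move, or a dummy one on halting. -/
def chosenMove (s : Memory I X Q) : StackMove X Q :=
  (M.chosen s).elim (fun _ => ⟨s.1, false, fun _ => false, fun _ => none⟩) id

/-- The program that makes the chosen move on the work stacks. -/
noncomputable def moveStmt : Stmt (Alphabet I X) Unit (Memory I X Q) :=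
  popStmt (fun s => (M.chosenMove s).pop) Finset.univ.toList <|
    pushStmt (fun s => (M.chosenMove s).push) Finset.univ.toList <|
      load (fun s => ((M.chosenMove s).state, none, fun _ => none)) <| goto fun _ => ()

/-- The program of one step. -/
noncomputable def stepStmt : Stmt (Alphabet I X) Unit (Memory I X Q) :=
  peek (.inl false) (fun s h => (s.1, h, s.2.2)) <| readStmt Finset.univ.toList <|
    branch (fun s => (M.chosen s).isLeft)
      (push (.inl true) (fun s => ((M.chosen s).elim id fun _ => false : Bool)) <|
        load (fun _ => (M.start, none, fun _ => none)) halt)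
      (branch (fun s => (M.chosenMove s).consume)
        (pop (.inl false) (fun s _ => s) M.moveStmt) M.moveStmt)

/-- The configuration of the compiled machine at the start of a step. -/
def compiledConfig (c : StackConfig I X Q) : Cfg (Alphabet I X) Unit (Memory I X Q) :=
  ⟨some (), (c.state, none, fun _ => none), stackContents c.input c.work⟩

theorem stepAux_moveStmt {s : Memory I X Q} {a : StackMove X Q} (h : M.chosen s = .inr a)
    (u : List I) (S : X → List Bool) :
    stepAux M.moveStmt s (stackContents u S) = ⟨some (), (a.state, none, fun _ => none),
      stackContents u fun x => (a.push x).toList ++ if a.pop x then (S x).tail else S x⟩ := by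
  have h' : M.chosenMove s = a := by simp [chosenMove, h]
  rw [moveStmt, stepAux_popStmt _ (Finset.nodup_toList _), stepAux_pushStmt _ (Finset.nodup_toList _),
    stepAux, stepAux]
  simp [h']

/-- `TM2.step` executes a whole statement up to its `goto`, so a move costs exactly one step however
many stacks it touches. -/
theorem step_of_action_eq_inr {c : StackConfig I X Q} {a : StackMove X Q}
    (h : M.action c = .inr a) :
    TM2.step (fun _ => M.stepStmt) (compiledConfig c) = some (compiledConfig (applyMove c a)) := by
  have hs : M.chosen (c.state, c.input.head?, fun x => (c.work x).head?) = .inr a := h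
  rw [compiledConfig, TM2.step, stepStmt, stepAux, stepAux_readStmt]
  have e : stackContents c.input c.work (Sum.inl false) = c.input := rfl
  simp only [Finset.mem_toList, Finset.mem_univ, if_true]
  erw [e]
  have h' : M.chosenMove (c.state, c.input.head?, fun x => (c.work x).head?) = a := by
    simp [chosenMove, hs]
  rw [stepAux, hs, Sum.isLeft_inr, cond_false, stepAux, h']
  cases hc : a.consume
  · rw [cond_false, stepAux_moveStmt M hs]
    simp [compiledConfig, applyMove, hc]
  · rw [cond_true, stepAux]
    erw [update_stackContents_input]
    rw [stepAux_moveStmt M hs]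
    simp [compiledConfig, applyMove, hc, stackContents]

theorem step_of_action_eq_inl {c : StackConfig I X Q} {b : Bool} (h : M.action c = .inl b) :
    TM2.step (fun _ => M.stepStmt) (compiledConfig c) =
      some ⟨none, (M.start, none, fun _ => none),
        Function.update (stackContents c.input c.work) (.inl true) [b]⟩ := by
  have hs : M.chosen (c.state, c.input.head?, fun x => (c.work x).head?) = .inl b := h
  rw [compiledConfig, TM2.step, stepStmt, stepAux, stepAux_readStmt]
  have e : stackContents c.input c.work (Sum.inl false) = c.input := rfl
  simp only [Finset.mem_toList, Finset.mem_univ, if_true]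
  erw [e]
  rw [stepAux, hs, Sum.isLeft_inl, cond_true, stepAux, hs]
  rfl

variable [Fintype I] [Fintype Q]

/-- The Turing machine that carries out the steps of `M`. -/
noncomputable def compile : FinTM2 where
  K := Bool ⊕ X
  k₀ := .inl false
  k₁ := .inl true
  Γ := Alphabet I X
  Λ := Unit
  main := ()
  σ := Memory I X Q
  initialState := (M.start, none, fun _ => none)
  Γk₀Fin := inferInstanceAs (Fintype I)
  m _ := M.stepStmt

end Compile

theorem ReachesWithin.exists_iterate [DecidableEq X] [Fintype X] {M : StackMachine I X Q} {n : ℕ}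
    {c c' : StackConfig I X Q} (h : M.ReachesWithin n c c') :
    ∃ k ≤ n, (flip bind (Turing.TM2.step fun _ => M.stepStmt))^[k] (some (compiledConfig c)) =
      some (compiledConfig c') := by
  induction h with
  | refl n c => exact ⟨0, Nat.zero_le _, rfl⟩
  | step h _ ih =>
    obtain ⟨k, hk, e⟩ := ih
    refine ⟨k + 1, by omega, ?_⟩
    rw [Function.iterate_succ_apply, ← e, ← step_of_action_eq_inr M h]
    rfl

/-- A property decided by a multi-stack machine in polynomially many steps is decidable in
polynomial time. -/
theorem decidableInPolyTime [DecidableEq X] [Fintype X] [Fintype I] [Fintype Q] {α : Type}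
    {enc : α → List I} {P : α → Prop} (p : Polynomial ℕ)
    (h : ∀ a, ∃ (q : Q) (b : Bool),
      M.ReachesWithin (p.eval (enc a).length) ⟨M.start, enc a, fun _ => []⟩ ⟨q, [], fun _ => []⟩ ∧
      M.action ⟨q, [], fun _ => []⟩ = .inl b ∧ (b = true ↔ P a)) :
    DecidableInPolyTime enc P := by
  classical
  choose q b hreach hhalt hb using h
  choose k hk e using fun a => (hreach a).exists_iterate
  refine ⟨{ tm := M.compile
            inputAlphabet := Equiv.refl I
            outputAlphabet := Equiv.refl Bool
            -- The additional step writes the answer and halts.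
            time := p + 1
            outputsFun := fun a => ⟨⟨k a + 1, ?_⟩, ?_⟩ }⟩
  · have hinit : Turing.initList M.compile (List.map (Equiv.refl I).invFun (enc a)) =
        compiledConfig ⟨M.start, enc a, fun _ => []⟩ := by
      refine (congrArg (Turing.initList M.compile)
        (List.map_id (enc a) : List.map (Equiv.refl I).invFun (enc a) = enc a)).trans ?_
      refine congrArg (Turing.TM2.Cfg.mk (some ()) (M.start, none, fun _ => none)) ?_
      funext k
      rcases k with (_ | _) | x <;> rfl
    -- `haltList` asks for the initial internal state and for empty stacks apart from the output.
    -- This is why the machine reloads its start state and must have emptied its input and work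
    -- stacks.
    have hfinal : Turing.haltList M.compile
        (List.map (Equiv.refl Bool).invFun (Computability.encodeBool (decide (P a)))) =
        ⟨none, (M.start, none, fun _ => none),
          Function.update (stackContents [] fun _ => []) (.inl true) [b a]⟩ := by
      have hbool : decide (P a) = b a := by
        rw [Bool.eq_iff_iff, decide_eq_true_iff, hb a]
      refine (congrArg (fun c => Turing.haltList M.compile
        (List.map (Equiv.refl Bool).invFun (Computability.encodeBool c))) hbool).trans ?_
      refine congrArg (Turing.TM2.Cfg.mk none (M.start, none, fun _ => none)) ?_
      funext k
      rcases k with (_ | _) | x <;> rfl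
    have hrun : (flip bind (Turing.TM2.step fun _ => M.stepStmt))^[k a + 1]
        (some (compiledConfig ⟨M.start, enc a, fun _ => []⟩)) =
        some ⟨none, (M.start, none, fun _ => none),
          Function.update (stackContents [] fun _ => []) (.inl true) [b a]⟩ := by
      rw [Function.iterate_succ_apply', e a]
      exact step_of_action_eq_inl M (hhalt a)
    exact (congrArg (fun c => (flip bind M.compile.step)^[k a + 1] (some c)) hinit).trans
      (hrun.trans (congrArg some hfinal.symm))
  · simpa using hk a

end StackMachine

/-! ### Binary digits and automata -/

instance : Finite MatrixSymbol :=
  Finite.of_surjective (fun x : Option Bool ⊕ Bool => match x with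
    | .inl none => MatrixSymbol.minus
    | .inl (some b) => .bit b
    | .inr false => .endEntry
    | .inr true => .endColumn) fun
    | .minus => ⟨.inl none, rfl⟩
    | .bit b => ⟨.inl (some b), rfl⟩
    | .endEntry => ⟨.inr false, rfl⟩
    | .endColumn => ⟨.inr true, rfl⟩

/-- The natural number with the given binary digits, least significant digit first. -/
def bitsValue (l : List Bool) : ℕ := l.foldr (fun b a => b.toNat + 2 * a) 0

theorem bitsValue_bits (n : ℕ) : bitsValue n.bits = n := by
  induction n using Nat.binaryRec' with
  | zero => simp [bitsValue]
  | bit b n h ih =>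
    rw [Nat.bits_append_bit _ _ h]
    change b.toNat + 2 * bitsValue n.bits = _
    rw [ih, Nat.bit_val]
    omega

theorem nat_bits_injective : Function.Injective Nat.bits :=
  Function.LeftInverse.injective bitsValue_bits

/-- A finite automaton reading vectors of signed binary digits, least significant digits first,
with the set of integer vectors accepted from each state. -/
structure DigitAutomaton (ι D : Type) where
  start : D
  next : D → (ι → ℤ) → D
  language : D → Set (ι → ℤ)
  language_next : ∀ d b, (∀ i, |b i| ≤ 1) → language (next d b) = {y | (2 : ℤ) • y + b ∈ language d}

/-- The sets of the family serve as states, each accepting itself. On vectors that are not digit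
vectors the state is arbitrarily left unchanged. -/
theorem IsBinaryRecognizable.exists_automaton {ι : Type} {T : Set (ι → ℤ)}
    (hT : IsBinaryRecognizable T) :
    ∃ (D : Type) (_ : Finite D) (A : DigitAutomaton ι D), A.language A.start = T := by
  classical
  obtain ⟨F, hF, hTF, hq⟩ := hT
  refine ⟨F, hF, ⟨⟨T, hTF⟩, fun S b => if h : ∀ i, |b i| ≤ 1 then ⟨_, hq S S.2 b h⟩ else S,
    fun S => S, fun S b h => ?_⟩, rfl⟩
  simp [h]

/-! ### The column machine and its loops -/

/-- The phases of the machine: reading a column, comparing it with the stored columns, restoring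
the stored columns, and running the automaton on the stored columns. -/
inductive Phase (m N : ℕ) (D : Type) : Type
  | read (row : Fin (m + 1))
  | compare (last : Bool) (eq : Fin N → Bool)
  | restore (dest : Option (Fin N))
  | run (d : D)
deriving Fintype

namespace ColumnMachine

open StackMachine

variable {m N : ℕ} {D : Type}

/-- Positions of entries: `(some j, i)` is row `i` of the `j`-th stored column, `(none, i)` is row
`i` of the current column. -/
abbrev Pos (m N : ℕ) : Type := Option (Fin N) × Fin m

/-- Finite control: the phase, the signs of all entries, the set of stored columns that are in use,
and whether a column could not be stored. -/
abbrev Control (m N : ℕ) (D : Type) : Type := Phase m N D × (Pos m N → Bool) × Finset (Fin N) × Bool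

/-- Where to store a column, given the set of used slots and the slots with the same column. -/
noncomputable def destination (filled : Finset (Fin N)) (eq : Fin N → Bool) : Option (Fin N) :=
  if ∃ j, eq j = true then none else if h : ∃ j, j ∉ filled then some h.choose else none

/-- Where the new contents of position `s` come from when the current column goes to `dest`. -/
def source (dest : Option (Fin N)) (s : Option (Fin N)) : Option (Fin N) :=
  if dest = s then none else s

/-- The digits on top of the stacks of the stored columns, with their signs. -/
def topDigits (neg : Pos m N → Bool) (top : Pos m N → Option Bool) (x : Fin N × Fin m) : ℤ :=
  (if neg (some x.1, x.2) then -1 else 1) * (top (some x.1, x.2)).toList.foldr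
    (fun b _ => (b.toNat : ℤ)) 0

/-- The move in the reading phase. -/
def readMove (row : Fin (m + 1)) (neg : Pos m N → Bool) (filled : Finset (Fin N)) (ov : Bool) :
    Option MatrixSymbol → StackMove (Bool × Pos m N) (Control m N D)
  | some .minus => ⟨(.read row,
      fun s => if s.1 = none ∧ (s.2 : ℕ) = row then true else neg s, filled, ov), true,
      fun _ => false, fun _ => none⟩
  | some (.bit b) => ⟨(.read row, neg, filled, ov), true, fun _ => false,
      fun x => if x.1 = false ∧ x.2.1 = none ∧ (x.2.2 : ℕ) = row then some b else none⟩
  | some .endEntry => ⟨(.read ⟨min (row + 1) m, by omega⟩, neg, filled, ov), true, fun _ => false,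
      fun _ => none⟩
  | some .endColumn => ⟨(.compare false fun j => decide (∀ i, neg (none, i) = neg (some j, i)),
      neg, filled, ov), true, fun _ => false, fun _ => none⟩
  | none => ⟨(.compare true fun j => decide (∀ i, neg (none, i) = neg (some j, i)),
      neg, filled, ov), false, fun _ => false, fun _ => none⟩

/-- The machine has two banks of stacks, each with a stack for each position. Between the phases
the digits are in the bank `false`, most significant digit on top. Comparing moves them to the bank
`true` and restoring moves them back. -/
noncomputable def machine (A : DigitAutomaton (Fin N × Fin m) D) :
    StackMachine MatrixSymbol (Bool × Pos m N) (Control m N D) where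
  start := (.read 0, fun _ => false, ∅, false)
  next := fun (phase, neg, filled, ov) symbol top => match phase with
    | .read row => .inr (readMove row neg filled ov symbol)
    | .compare last eq =>
      if ∀ s, top (false, s) = none then
        if last then .inr ⟨(.run A.start, neg, filled, ov), false, fun _ => false, fun _ => none⟩
        else .inr ⟨(.restore (destination filled eq),
          fun s => s.1.isSome && neg (source (destination filled eq) s.1, s.2),
          filled ∪ (destination filled eq).toFinset,
          ov || ((destination filled eq).isNone && decide (∀ j, eq j = false))),
          false, fun _ => false, fun _ => none⟩
      else .inr ⟨(.compare last fun j =>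
          eq j && decide (∀ i, top (false, none, i) = top (false, some j, i)), neg, filled, ov),
        false, fun x => !x.1, fun x => if x.1 then top (false, x.2) else none⟩
    | .restore dest =>
      if ∀ s, top (true, s) = none then
        .inr ⟨(.read 0, neg, filled, ov), false, fun _ => false, fun _ => none⟩
      else .inr ⟨(.restore dest, neg, filled, ov), false, fun x => x.1,
        fun x => if !x.1 && x.2.1.isSome then top (true, source dest x.2.1, x.2.2) else none⟩
    | .run d =>
      if ∀ s, top (true, s) = none then
        .inl (!ov && @decide (0 ∈ A.language d) (Classical.propDecidable _))
      else .inr ⟨(.run (A.next d (topDigits neg fun s => top (true, s))), neg, filled, ov), false,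
        fun x => x.1, fun _ => none⟩

/-- The contents of both banks. -/
def banks (R F : Pos m N → List Bool) (x : Bool × Pos m N) : List Bool :=
  if x.1 then F x.2 else R x.2

variable (A : DigitAutomaton (Fin N × Fin m) D)

theorem eq_nil_of_heads {S : Pos m N → List Bool} (h : ∀ s, (S s).head? = none) :
    S = fun _ => [] :=
  funext fun s => List.head?_eq_none_iff.1 (h s)

theorem tail_reverse_append (l F : List Bool) :
    l.tail.reverse ++ (l.head?.toList ++ F) = l.reverse ++ F := by
  cases l <;> simp

theorem eq_iff_head_tail (l l' : List Bool) : l = l' ↔ l.head? = l'.head? ∧ l.tail = l'.tail := by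
  cases l <;> cases l' <;> simp

/-- Two words agree iff their heads and tails do, where the head of an exhausted stack is `none`; so
words of different length are told apart. The transfer reverses the stacks. -/
theorem reaches_compare (ℓ : ℕ) (u : List MatrixSymbol) (last : Bool) (eq : Fin N → Bool)
    (c : (Pos m N → Bool) × Finset (Fin N) × Bool) (R F : Pos m N → List Bool)
    (hR : ∀ s, (R s).length ≤ ℓ) :
    (machine A).ReachesWithin ℓ ⟨(.compare last eq, c), u, banks R F⟩
      ⟨(.compare last fun j => eq j && decide (∀ i, R (none, i) = R (some j, i)), c), u,
        banks (fun _ => []) fun s => (R s).reverse ++ F s⟩ := by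
  induction ℓ generalizing eq R F with
  | zero =>
    have : R = fun _ => [] := funext fun s => List.length_eq_zero_iff.1 (Nat.le_zero.1 (hR s))
    subst this
    simpa using ReachesWithin.refl _ _
  | succ ℓ ih =>
    by_cases hs : ∀ s, (R s).head? = none
    · obtain rfl := eq_nil_of_heads hs
      simpa using ReachesWithin.refl _ _
    · refine .step (a := ⟨(.compare last fun j => eq j &&
        decide (∀ i, (R (none, i)).head? = (R (some j, i)).head?), c),
        false, fun x => !x.1, fun x => if x.1 then (R x.2).head? else none⟩) ?_ ?_
      · obtain ⟨neg, filled, ov⟩ := c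
        simp only [action, machine, banks]
        exact if_neg hs
      · have h := ih (fun j => eq j && decide (∀ i, (R (none, i)).head? = (R (some j, i)).head?))
          (fun s => (R s).tail) (fun s => (R s).head?.toList ++ F s)
          (fun s => by have := hR s; simp; omega)
        refine h.congr (StackConfig.ext rfl rfl (funext fun x => ?_))
          (StackConfig.ext ?_ rfl (funext fun x => ?_))
        · rcases x with ⟨_ | _, s⟩ <;> simp [banks, applyMove]
        · refine congrArg (fun e => (Phase.compare last e, c)) (funext fun j => ?_)
          simp only [Bool.and_assoc, ← Bool.decide_and, ← forall_and, ← eq_iff_head_tail]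
        · rcases x with ⟨_ | _, s⟩ <;> simp [banks, tail_reverse_append]

/-- This second reversal undoes that of the comparison. Position `none` receives nothing, which
clears the current column. -/
theorem reaches_restore (ℓ : ℕ) (u : List MatrixSymbol) (dest : Option (Fin N))
    (c : (Pos m N → Bool) × Finset (Fin N) × Bool) (R F : Pos m N → List Bool)
    (hF : ∀ s, (F s).length ≤ ℓ) :
    (machine A).ReachesWithin ℓ ⟨(.restore dest, c), u, banks R F⟩
      ⟨(.restore dest, c), u,
        banks (fun s => (if s.1.isSome then (F (source dest s.1, s.2)).reverse else []) ++ R s)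
          fun _ => []⟩ := by
  induction ℓ generalizing R F with
  | zero =>
    have : F = fun _ => [] := funext fun s => List.length_eq_zero_iff.1 (Nat.le_zero.1 (hF s))
    subst this
    simpa using ReachesWithin.refl _ _
  | succ ℓ ih =>
    by_cases hs : ∀ s, (F s).head? = none
    · obtain rfl := eq_nil_of_heads hs
      simpa using ReachesWithin.refl _ _
    · refine .step (a := ⟨(.restore dest, c), false, fun x => x.1,
        fun x => if !x.1 && x.2.1.isSome then (F (source dest x.2.1, x.2.2)).head? else none⟩) ?_ ?_
      · obtain ⟨neg, filled, ov⟩ := c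
        simp only [action, machine, banks]
        exact if_neg hs
      · have h := ih (fun s => (if s.1.isSome then
            (F (source dest s.1, s.2)).head?.toList else []) ++ R s) (fun s => (F s).tail)
          (fun s => by have := hF s; simp; omega)
        refine h.congr (StackConfig.ext rfl rfl (funext fun x => ?_))
          (StackConfig.ext rfl rfl (funext fun x => ?_))
        · rcases x with ⟨_ | _, _ | j, i⟩ <;> simp [banks, applyMove]
        · rcases x with ⟨_ | _, _ | j, i⟩ <;> simp [banks, tail_reverse_append]

/-- The value of a stored entry. -/
def signedValue (neg : Pos m N → Bool) (F : Pos m N → List Bool) (x : Fin N × Fin m) : ℤ :=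
  (if neg (some x.1, x.2) then -1 else 1) * (bitsValue (F (some x.1, x.2)) : ℤ)

theorem abs_topDigits_le (neg : Pos m N → Bool) (top : Pos m N → Option Bool)
    (x : Fin N × Fin m) : |topDigits neg top x| ≤ 1 := by
  rw [topDigits]
  cases neg (some x.1, x.2) <;> rcases top (some x.1, x.2) with _ | _ | _ <;> simp

/-- The sign of an entry is given to each of its digits, and an exhausted stack supplies the digit
`0`, so entries of different lengths can be read in parallel. -/
theorem signedValue_eq (neg : Pos m N → Bool) (F : Pos m N → List Bool) :
    signedValue neg F = (2 : ℤ) • signedValue neg (fun s => (F s).tail) +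
      topDigits neg fun s => (F s).head? := by
  funext x
  simp only [signedValue, topDigits, Pi.add_apply, Pi.smul_apply, smul_eq_mul]
  cases F (some x.1, x.2) with
  | nil => simp [bitsValue]
  | cons b l =>
    have : bitsValue (b :: l) = b.toNat + 2 * bitsValue l := rfl
    simp only [this, List.tail_cons, List.head?_cons, Option.toList_some, List.foldr_cons]
    push_cast
    ring

/-- The invariant is membership of the unread value in the language of the current state; once the
stacks are empty this value is `0`. -/
theorem reaches_run (ℓ : ℕ) (u : List MatrixSymbol) (d : D) (neg : Pos m N → Bool)
    (c : Finset (Fin N) × Bool) (F : Pos m N → List Bool) (hF : ∀ s, (F s).length ≤ ℓ) :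
    ∃ d', (machine A).ReachesWithin ℓ ⟨(.run d, neg, c), u, banks (fun _ => []) F⟩
      ⟨(.run d', neg, c), u, fun _ => []⟩ ∧
      (0 ∈ A.language d' ↔ signedValue neg F ∈ A.language d) := by
  have hnil : (banks (fun _ => []) fun _ => [] : Bool × Pos m N → List Bool) = fun _ => [] := by
    funext x
    simp [banks]
  have hzero : signedValue neg (fun _ => []) = 0 := by
    funext x
    simp [signedValue, bitsValue]
  induction ℓ generalizing d F with
  | zero =>
    have : F = fun _ => [] := funext fun s => List.length_eq_zero_iff.1 (Nat.le_zero.1 (hF s))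
    subst this
    exact ⟨d, hnil ▸ .refl _ _, by rw [hzero]⟩
  | succ ℓ ih =>
    by_cases hs : ∀ s, (F s).head? = none
    · obtain rfl := eq_nil_of_heads hs
      exact ⟨d, hnil ▸ .refl _ _, by rw [hzero]⟩
    · obtain ⟨d', hd', h⟩ := ih (A.next d (topDigits neg fun s => (F s).head?))
        (fun s => (F s).tail) (fun s => by have := hF s; simp; omega)
      refine ⟨d', .step (a := ⟨(.run (A.next d (topDigits neg fun s => (F s).head?)), neg, c),
        false, fun x => x.1, fun _ => none⟩) ?_ ?_, ?_⟩
      · obtain ⟨filled, ov⟩ := c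
        simp only [action, machine, banks]
        exact if_neg hs
      · refine hd'.congr (StackConfig.ext rfl rfl (funext fun x => ?_)) rfl
        rcases x with ⟨_ | _, s⟩ <;> simp [banks, applyMove]
      · rw [h, A.language_next _ _ (abs_topDigits_le _ _), Set.mem_ofPred_eq, ← signedValue_eq]

end ColumnMachine

/-! ### Processing one column, and the end of the input -/

namespace ColumnMachine

open StackMachine

variable {m N : ℕ} {D : Type} (A : DigitAutomaton (Fin N × Fin m) D)

theorem update_none_apply {α : Type*} (f : Pos m N → α) (i : Fin m) (a : α) (s : Pos m N) :
    Function.update f (none, i) a s = if s.1 = none ∧ (s.2 : ℕ) = i then a else f s := by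
  simp only [Function.update_apply, Prod.ext_iff, Fin.ext_iff]

theorem reaches_read_bits (i : Fin m) (l : List Bool) (u : List MatrixSymbol)
    (c : (Pos m N → Bool) × Finset (Fin N) × Bool) (R F : Pos m N → List Bool) :
    (machine A).ReachesWithin l.length
      ⟨(.read i.castSucc, c), l.map MatrixSymbol.bit ++ u, banks R F⟩
      ⟨(.read i.castSucc, c), u,
        banks (Function.update R (none, i) (l.reverse ++ R (none, i))) F⟩ := by
  induction l generalizing R with
  | nil => simpa using ReachesWithin.refl _ _
  | cons b l ih =>
    obtain ⟨neg, filled, ov⟩ := c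
    refine .step (a := readMove i.castSucc neg filled ov (some (.bit b))) rfl ?_
    refine (ih (Function.update R (none, i) (b :: R (none, i)))).congr
      (StackConfig.ext rfl rfl (funext fun x => ?_)) (StackConfig.ext rfl rfl ?_)
    · rcases x with ⟨_ | _, s⟩
      · simp only [banks, applyMove, readMove, update_none_apply, Fin.val_castSucc]
        by_cases h : s.1 = none ∧ (s.2 : ℕ) = i
        · have hs : s = (none, i) := Prod.ext h.1 (Fin.ext h.2)
          simp [hs]
        · simp [h]
      · simp [banks, applyMove, readMove]
    · simp

/-- The machine between two phases, with entries `V` stored in the first bank. -/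
def stored (phase : Phase m N D) (V : Pos m N → ℤ) (filled : Finset (Fin N)) (ov : Bool)
    (u : List MatrixSymbol) : StackConfig MatrixSymbol (Bool × Pos m N) (Control m N D) :=
  ⟨(phase, fun s => decide (V s < 0), filled, ov), u,
    banks (fun s => (V s).natAbs.bits.reverse) fun _ => []⟩

/-- `hV` provides an empty stack and the sign bit `false`, which is correct for nonnegative entries
since these carry no sign symbol. -/
theorem reaches_read_entry (i : Fin m) (z : ℤ) (u : List MatrixSymbol) {V : Pos m N → ℤ}
    (hV : V (none, i) = 0) (filled : Finset (Fin N)) (ov : Bool) :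
    (machine A).ReachesWithin (encodeEntry z).length
      (stored (.read i.castSucc) V filled ov (encodeEntry z ++ u))
      (stored (.read i.succ) (Function.update V (none, i) z) filled ov u) := by
  let neg : Pos m N → Bool := fun s => decide (V s < 0)
  let neg' : Pos m N → Bool := fun s => decide (Function.update V (none, i) z s < 0)
  let R : Pos m N → List Bool := fun s => (V s).natAbs.bits.reverse
  have hsign : (machine A).ReachesWithin (if z < 0 then [MatrixSymbol.minus] else []).length
      (stored (.read i.castSucc) V filled ov (encodeEntry z ++ u))
      ⟨(.read i.castSucc, neg', filled, ov),
        z.natAbs.bits.map MatrixSymbol.bit ++ MatrixSymbol.endEntry :: u,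
        banks R fun _ => []⟩ := by
    by_cases hz : z < 0
    · rw [if_pos hz]
      refine .single (a := readMove i.castSucc neg filled ov (some .minus)) ?_
        (StackConfig.ext ?_ ?_ rfl)
      · simp [action, stored, machine, encodeEntry, hz, neg]
      · refine congrArg (fun n => ((.read i.castSucc, n, filled, ov) : Control m N D)) ?_
        funext s
        simp only [neg', neg, update_none_apply, Fin.val_castSucc]
        split_ifs <;> simp [hz]
      · simp [applyMove, readMove, stored, encodeEntry, hz]
    · rw [if_neg hz]
      refine (ReachesWithin.refl _ _).congr ?_ rfl
      refine StackConfig.ext ?_ ?_ rfl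
      · refine congrArg (fun n => ((.read i.castSucc, n, filled, ov) : Control m N D)) ?_
        funext s
        simp only [neg', update_none_apply]
        split_ifs with h
        · have hs : s = (none, i) := Prod.ext h.1 (Fin.ext h.2)
          simp [hs, hV, hz]
        · rfl
      · simp [stored, encodeEntry, hz]
  have hbits := reaches_read_bits A i z.natAbs.bits (MatrixSymbol.endEntry :: u)
    (neg', filled, ov) R fun _ => []
  have hend : (machine A).ReachesWithin 1
      ⟨(.read i.castSucc, neg', filled, ov), MatrixSymbol.endEntry :: u,
        banks (Function.update R (none, i) (z.natAbs.bits.reverse ++ R (none, i))) fun _ => []⟩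
      (stored (.read i.succ) (Function.update V (none, i) z) filled ov u) := by
    refine .single (a := readMove i.castSucc neg' filled ov (some .endEntry)) rfl
      (StackConfig.ext ?_ rfl (funext fun x => ?_))
    · refine congrArg (fun r => ((.read r, neg', filled, ov) : Control m N D)) (Fin.ext ?_)
      simp
    · rcases x with ⟨_ | _, s⟩
      · simp only [stored, banks, applyMove, readMove, R, update_none_apply]
        by_cases h : s.1 = none ∧ (s.2 : ℕ) = i <;> simp [h, hV]
      · simp [stored, banks, applyMove, readMove]
  have h := (hsign.trans hbits).trans hend
  exact h.mono (by simp [encodeEntry])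

/-- The stored columns together with the current one. -/
def withCurrent (T : Fin N → Fin m → ℤ) (v : Fin m → ℤ) (s : Pos m N) : ℤ :=
  s.1.elim (v s.2) fun j => T j s.2

theorem reaches_read_entries (T : Fin N → Fin m → ℤ) (v : Fin m → ℤ) (u : List MatrixSymbol)
    (filled : Finset (Fin N)) (ov : Bool) (k t : ℕ) (hk : t + k = m) :
    (machine A).ReachesWithin
      ((List.ofFn fun i => encodeEntry (v i)).drop t).flatten.length
      (stored (.read ⟨t, by omega⟩) (withCurrent T fun i => if (i : ℕ) < t then v i else 0)
        filled ov (((List.ofFn fun i => encodeEntry (v i)).drop t).flatten ++ u))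
      (stored (.read (Fin.last m)) (withCurrent T v) filled ov u) := by
  induction k generalizing t with
  | zero =>
    obtain rfl : t = m := by omega
    rw [List.drop_eq_nil_of_le (by simp)]
    refine (ReachesWithin.refl _ _).congr ?_ rfl
    simp only [Fin.is_lt, if_true]
    rfl
  | succ k ih =>
    have ht : t < m := by omega
    rw [List.drop_eq_getElem_cons (by simpa using ht), List.flatten_cons, List.getElem_ofFn,
      List.length_append, List.append_assoc]
    refine (reaches_read_entry A ⟨t, ht⟩ (v ⟨t, ht⟩) _ (by simp [withCurrent]) filled ov).trans ?_
    refine (ih (t + 1) (by omega)).congr ?_ rfl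
    congr 1
    funext s
    rcases s with ⟨_ | j, i⟩
    · rw [update_none_apply]
      simp only [withCurrent, Option.elim_none, true_and]
      by_cases h : (i : ℕ) = t
      · obtain rfl : i = ⟨t, ht⟩ := Fin.ext h
        simp
      · rw [if_neg h]
        congr 1
        simp only [eq_iff_iff]
        omega
    · rw [update_none_apply]
      simp [withCurrent]

/-- A table of columns: the stored columns, the set of slots in use, and whether some column could
not be stored. -/
structure Table (m N : ℕ) where
  slot : Fin N → Fin m → ℤ
  filled : Finset (Fin N)
  overflow : Bool

/-- The slot in which a column is to be stored. -/
noncomputable def Table.dest (T : Table m N) (v : Fin m → ℤ) : Option (Fin N) :=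
  destination T.filled fun j => decide (v = T.slot j)

/-- The table after a column has been processed. -/
noncomputable def Table.insert (T : Table m N) (v : Fin m → ℤ) : Table m N where
  slot j := if T.dest v = some j then v else T.slot j
  filled := T.filled ∪ (T.dest v).toFinset
  overflow := T.overflow || ((T.dest v).isNone && decide (∀ j, v ≠ T.slot j))

/-- The machine before reading a column. -/
def ready (T : Table m N) (u : List MatrixSymbol) :
    StackConfig MatrixSymbol (Bool × Pos m N) (Control m N D) :=
  stored (.read 0) (withCurrent T.slot 0) T.filled T.overflow u

theorem sign_bits_eq_iff (a b : ℤ) :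
    decide (a < 0) = decide (b < 0) ∧ a.natAbs.bits.reverse = b.natAbs.bits.reverse ↔ a = b := by
  rw [List.reverse_inj, nat_bits_injective.eq_iff, decide_eq_decide]
  omega

theorem sign_mul_natAbs (z : ℤ) : (if decide (z < 0) then -1 else 1) * (z.natAbs : ℤ) = z := by
  simp only [decide_eq_true_eq]
  split_ifs <;> omega

/-- The binary lengths of all entries of a vector are at most `ℓ`. -/
def BitsLE (ℓ : ℕ) (v : Fin m → ℤ) : Prop := ∀ i, (v i).natAbs.bits.length ≤ ℓ

theorem reaches_compare_stored {ℓ : ℕ} {T : Table m N} {v : Fin m → ℤ} (hv : BitsLE ℓ v)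
    (hT : ∀ j, BitsLE ℓ (T.slot j)) (last : Bool) (u : List MatrixSymbol) :
    (machine A).ReachesWithin ℓ
      (stored (.compare last fun j => decide (∀ i, decide (v i < 0) = decide (T.slot j i < 0)))
        (withCurrent T.slot v) T.filled T.overflow u)
      ⟨(.compare last fun j => decide (v = T.slot j),
        fun s => decide (withCurrent T.slot v s < 0), T.filled, T.overflow), u,
        banks (fun _ => []) fun s => (withCurrent T.slot v s).natAbs.bits⟩ := by
  refine (reaches_compare A ℓ u last _ _ _ _ ?_).congr rfl
    (StackConfig.ext ?_ rfl (by simp))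
  · rintro ⟨_ | j, i⟩
    · simpa [withCurrent] using hv i
    · simpa [withCurrent] using hT j i
  · refine congrArg (fun e => ((.compare last e, _) : Control m N D)) (funext fun j => ?_)
    rw [← Bool.decide_and, decide_eq_decide, ← forall_and, funext_iff]
    exact forall_congr' fun i => (sign_bits_eq_iff _ _).symm

/-- Besides reading the column, the cost is `ℓ` steps each for comparing and restoring, and one step
for leaving each of these phases. -/
theorem reaches_insert {ℓ : ℕ} {T : Table m N} {v : Fin m → ℤ} (hv : BitsLE ℓ v)
    (hT : ∀ j, BitsLE ℓ (T.slot j)) (u : List MatrixSymbol) :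
    (machine A).ReachesWithin ((encodeColumn v).length + (2 * ℓ + 2))
      (ready T (encodeColumn v ++ u)) (ready (T.insert v) u) := by
  have h1 := reaches_read_entries A T.slot v (MatrixSymbol.endColumn :: u) T.filled T.overflow m 0
    (by omega)
  have h2 : (machine A).ReachesWithin 1
      (stored (.read (Fin.last m)) (withCurrent T.slot v) T.filled T.overflow
        (MatrixSymbol.endColumn :: u))
      (stored (.compare false fun j => decide (∀ i, decide (v i < 0) = decide (T.slot j i < 0)))
        (withCurrent T.slot v) T.filled T.overflow u) :=
    .single (a := readMove _ _ _ _ (some .endColumn)) rfl rfl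
  have h3 := reaches_compare_stored A hv hT false u
  let neg' : Pos m N → Bool := fun s =>
    s.1.isSome && decide (withCurrent T.slot v (source (T.dest v) s.1, s.2) < 0)
  have h4 : (machine A).ReachesWithin 1
      ⟨(.compare false fun j => decide (v = T.slot j),
        fun s => decide (withCurrent T.slot v s < 0), T.filled, T.overflow), u,
        banks (fun _ => []) fun s => (withCurrent T.slot v s).natAbs.bits⟩
      ⟨(.restore (T.dest v), neg', (T.insert v).filled, (T.insert v).overflow), u,
        banks (fun _ => []) fun s => (withCurrent T.slot v s).natAbs.bits⟩ := by
    refine .single (a := ⟨(.restore (T.dest v), neg', (T.insert v).filled, (T.insert v).overflow),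
      false, fun _ => false, fun _ => none⟩) ?_ rfl
    simp only [action, machine, banks]
    rw [if_neg Bool.false_ne_true]
    refine (if_pos (fun _ => rfl)).trans ?_
    simp [Table.dest, Table.insert, neg']
    rfl
  have h5 := reaches_restore A ℓ u (T.dest v)
    (neg', (T.insert v).filled, (T.insert v).overflow) (fun _ => [])
    (fun s => (withCurrent T.slot v s).natAbs.bits) (by
      rintro ⟨_ | j, i⟩
      · simpa [withCurrent] using hv i
      · simpa [withCurrent] using hT j i)
  have hsource (j : Fin N) (i : Fin m) : withCurrent T.slot v (source (T.dest v) (some j), i) =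
      (T.insert v).slot j i := by
    by_cases h : T.dest v = some j <;> simp [source, withCurrent, Table.insert, h]
  have h6 : (machine A).ReachesWithin 1
      ⟨(.restore (T.dest v), neg', (T.insert v).filled, (T.insert v).overflow), u,
        banks (fun s => (if s.1.isSome then
          (withCurrent T.slot v (source (T.dest v) s.1, s.2)).natAbs.bits.reverse else []) ++ [])
          fun _ => []⟩
      (ready (T.insert v) u) := by
    refine .single (a := ⟨(.read 0, neg', (T.insert v).filled, (T.insert v).overflow),
      false, fun _ => false, fun _ => none⟩) ?_ (StackConfig.ext ?_ rfl (funext fun x => ?_))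
    · simp only [action, machine, banks]
      exact if_pos (fun _ => rfl)
    · refine congrArg (fun n => ((.read 0, n, _) : Control m N D)) (funext fun s => ?_)
      rcases s with ⟨_ | j, i⟩
      · simp [neg', withCurrent]
      · simp only [neg', hsource]
        simp [withCurrent]
        rfl
    · rcases x with ⟨_ | _, _ | j, i⟩
      · simp [applyMove, banks, ready, stored, withCurrent]
      · simp only [applyMove, banks, ready, stored, hsource]
        simp [withCurrent]
      · simp [applyMove, banks, ready, stored]
      · simp [applyMove, banks, ready, stored]
  have h := ((((h1.trans h2).trans h3).trans h4).trans h5).trans h6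
  refine (h.mono ?_).congr ?_ rfl
  · simp [encodeColumn]
    omega
  · simp [ready, encodeColumn]
    rfl

/-- The final comparison, with a zero current column, serves only to bring the least significant
digits to the top for the automaton. -/
theorem reaches_end {ℓ : ℕ} {T : Table m N} (hT : ∀ j, BitsLE ℓ (T.slot j)) :
    ∃ (q : Control m N D) (b : Bool),
      (machine A).ReachesWithin (2 * ℓ + 2) (ready T []) ⟨q, [], fun _ => []⟩ ∧
      (machine A).action ⟨q, [], fun _ => []⟩ = .inl b ∧
      (b = true ↔ T.overflow = false ∧
        (fun x : Fin N × Fin m => T.slot x.1 x.2) ∈ A.language A.start) := by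
  have h1 : (machine A).ReachesWithin 1 (ready T [])
      (stored (.compare true fun j => decide (∀ i,
        decide ((0 : Fin m → ℤ) i < 0) = decide (T.slot j i < 0)))
        (withCurrent T.slot 0) T.filled T.overflow []) :=
    .single (a := readMove _ _ _ _ none) rfl rfl
  have h2 := reaches_compare_stored A (ℓ := ℓ) (v := 0) (by intro i; simp) hT true []
  have h3 : (machine A).ReachesWithin 1
      ⟨(.compare true fun j => decide (0 = T.slot j),
        fun s => decide (withCurrent T.slot 0 s < 0), T.filled, T.overflow), [],
        banks (fun _ => []) fun s => (withCurrent T.slot 0 s).natAbs.bits⟩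
      ⟨(.run A.start, fun s => decide (withCurrent T.slot 0 s < 0), T.filled, T.overflow), [],
        banks (fun _ => []) fun s => (withCurrent T.slot 0 s).natAbs.bits⟩ := by
    refine .single (a := ⟨(.run A.start, fun s => decide (withCurrent T.slot 0 s < 0), T.filled,
      T.overflow), false, fun _ => false, fun _ => none⟩) ?_ rfl
    simp only [action, machine, banks]
    exact (if_pos (fun _ => rfl)).trans (if_pos trivial)
  obtain ⟨d, h4, hd⟩ := reaches_run A ℓ [] A.start
    (fun s => decide (withCurrent T.slot 0 s < 0)) (T.filled, T.overflow)
    (fun s => (withCurrent T.slot 0 s).natAbs.bits) (by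
      rintro ⟨_ | j, i⟩
      · simp [withCurrent]
      · simpa [withCurrent] using hT j i)
  refine ⟨_, _, (((h1.trans h2).trans h3).trans h4).mono (by omega), if_pos fun _ => rfl, ?_⟩
  have hvalue : signedValue (fun s => decide (withCurrent T.slot 0 s < 0))
      (fun s => (withCurrent T.slot 0 s).natAbs.bits) = fun x => T.slot x.1 x.2 := by
    funext x
    simp only [signedValue, bitsValue_bits]
    exact sign_mul_natAbs _
  rw [hvalue] at hd
  simp [hd]

end ColumnMachine

/-! ### The table of distinct columns -/

namespace ColumnMachine

open StackMachine

variable {m N : ℕ} {D : Type}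

theorem destination_eq_some {filled : Finset (Fin N)} {eq : Fin N → Bool} {j : Fin N}
    (h : destination filled eq = some j) : j ∉ filled ∧ ∀ j', eq j' = false := by
  unfold destination at h
  split_ifs at h with h1 h2
  · obtain rfl := Option.some.inj h
    exact ⟨h2.choose_spec, by simpa using h1⟩

theorem destination_eq_none {filled : Finset (Fin N)} {eq : Fin N → Bool}
    (h : destination filled eq = none) (heq : ∀ j, eq j = false) : ∀ j, j ∈ filled := by
  unfold destination at h
  rw [if_neg (by simp [heq])] at h
  split_ifs at h with h2
  simpa using h2

/-- The table stores the columns in `P`, unless there are too many of them. -/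
structure Table.Represents (T : Table m N) (P : Finset (Fin m → ℤ)) : Prop where
  slot_eq_zero : ∀ j ∉ T.filled, T.slot j = 0
  slot_mem : ∀ j ∈ T.filled, T.slot j ∈ P
  slot_injOn : Set.InjOn T.slot T.filled
  exists_slot : T.overflow = false → ∀ v ∈ P, v = 0 ∨ ∃ j, v = T.slot j
  lt_card : T.overflow = true → N < P.card

theorem Table.Represents.insert {T : Table m N} {P : Finset (Fin m → ℤ)} (h : T.Represents P)
    (v : Fin m → ℤ) : (T.insert v).Represents (Insert.insert v P) := by
  cases hd : T.dest v with
  | some j₀ =>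
    obtain ⟨hj₀, hnew⟩ := destination_eq_some hd
    simp only [decide_eq_false_iff_not] at hnew
    have hslot : (T.insert v).slot = Function.update T.slot j₀ v := by
      funext j
      simp only [Table.insert, hd, Option.some.injEq, Function.update_apply, eq_comm]
    have hfilled : (T.insert v).filled = Insert.insert j₀ T.filled := by
      simp [Table.insert, hd]
    have hov : (T.insert v).overflow = T.overflow := by simp [Table.insert, hd]
    refine ⟨fun j hj => ?_, fun j hj => ?_, ?_, fun ho w hw => ?_, fun ho => ?_⟩
    · rw [hfilled, Finset.mem_insert, not_or] at hj
      rw [hslot, Function.update_of_ne hj.1, h.slot_eq_zero j hj.2]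
    · rw [hslot]
      by_cases hjj : j = j₀
      · subst hjj
        simp
      · rw [hfilled, Finset.mem_insert] at hj
        rw [Function.update_of_ne hjj]
        exact Finset.mem_insert_of_mem (h.slot_mem j (hj.resolve_left hjj))
    · have hoff : Set.EqOn T.slot (Function.update T.slot j₀ v) T.filled := fun j hj => by
        rw [Function.update_of_ne]
        rintro rfl
        exact hj₀ hj
      rw [hslot, hfilled, Finset.coe_insert, Set.injOn_insert (by simpa using hj₀)]
      refine ⟨h.slot_injOn.congr hoff, ?_⟩
      rintro ⟨j, hj, e⟩
      rw [Function.update_self, ← hoff hj] at e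
      exact hnew j e.symm
    · rw [hov] at ho
      rw [hslot]
      rcases Finset.mem_insert.1 hw with rfl | hw
      · exact Or.inr ⟨j₀, by simp⟩
      rcases h.exists_slot ho w hw with h0 | ⟨j, hj⟩
      · exact Or.inl h0
      -- The overwritten slot was unused and held `0`, so only the zero column can lose its match.
      by_cases hjj : j = j₀
      · subst hjj
        exact Or.inl (hj.trans (h.slot_eq_zero j hj₀))
      · exact Or.inr ⟨j, by rw [Function.update_of_ne hjj, hj]⟩
    · rw [hov] at ho
      exact (h.lt_card ho).trans_le (Finset.card_le_card (Finset.subset_insert _ _))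
  | none =>
    have hslot : (T.insert v).slot = T.slot := by
      funext j
      simp [Table.insert, hd]
    have hfilled : (T.insert v).filled = T.filled := by simp [Table.insert, hd]
    have hov : (T.insert v).overflow = (T.overflow || decide (∀ j, v ≠ T.slot j)) := by
      simp [Table.insert, hd]
    refine ⟨by simpa only [hslot, hfilled] using h.slot_eq_zero, fun j hj => ?_,
      by simpa only [hslot, hfilled] using h.slot_injOn, fun ho w hw => ?_, fun ho => ?_⟩
    · rw [hslot]
      exact Finset.mem_insert_of_mem (h.slot_mem j (hfilled ▸ hj))
    · rw [hov, Bool.or_eq_false_iff, decide_eq_false_iff_not] at ho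
      rw [hslot]
      rcases Finset.mem_insert.1 hw with rfl | hw
      · right
        simpa using ho.2
      · exact h.exists_slot ho.1 w hw
    · rw [hov, Bool.or_eq_true, decide_eq_true_iff] at ho
      rcases ho with ho | ho
      · exact (h.lt_card ho).trans_le (Finset.card_le_card (Finset.subset_insert _ _))
      -- A new overflow means that all `N` slots hold distinct columns from `P` and `v` differs from
      -- each of them.
      have hfull := destination_eq_none hd (by simpa using ho)
      have hinj : Function.Injective T.slot := fun a b e => h.slot_injOn (hfull a) (hfull b) e
      have hv : v ∉ Finset.univ.image T.slot := by
        simpa [eq_comm] using ho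
      have hsub : Insert.insert v (Finset.univ.image T.slot) ⊆ Insert.insert v P :=
        Finset.insert_subset_insert _ (by
          intro w hw
          obtain ⟨j, -, rfl⟩ := Finset.mem_image.1 hw
          exact h.slot_mem j (hfull j))
      have hcard := Finset.card_le_card hsub
      rw [Finset.card_insert_of_notMem hv, Finset.card_image_of_injective _ hinj,
        Finset.card_univ, Fintype.card_fin] at hcard
      omega

theorem Table.Represents.bitsLE {T : Table m N} {P : Finset (Fin m → ℤ)} (h : T.Represents P)
    {ℓ : ℕ} (hP : ∀ v ∈ P, BitsLE ℓ v) (j : Fin N) : BitsLE ℓ (T.slot j) := by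
  by_cases hj : j ∈ T.filled
  · exact hP _ (h.slot_mem j hj)
  · rw [h.slot_eq_zero j hj]
    intro i
    simp

theorem reaches_columns (A : DigitAutomaton (Fin N × Fin m) D) {ℓ : ℕ}
    (cols : List (Fin m → ℤ)) {T : Table m N} {P : Finset (Fin m → ℤ)} (h : T.Represents P)
    (hP : ∀ v ∈ P, BitsLE ℓ v) (hcols : ∀ v ∈ cols, BitsLE ℓ v) :
    ∃ T' : Table m N, T'.Represents (cols.toFinset ∪ P) ∧
      (machine A).ReachesWithin
        ((cols.map encodeColumn).flatten.length + cols.length * (2 * ℓ + 2))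
        (ready T (cols.map encodeColumn).flatten) (ready T' []) := by
  induction cols generalizing T P with
  | nil => exact ⟨T, by simpa using h, .refl _ _⟩
  | cons v cols ih =>
    obtain ⟨T', hT', hreach⟩ := ih (h.insert v)
      (fun w hw => (Finset.mem_insert.1 hw).elim
        (fun e => e ▸ hcols v List.mem_cons_self) (hP w))
      fun w hw => hcols w (List.mem_cons_of_mem _ hw)
    refine ⟨T', by simpa using hT', ?_⟩
    have hfirst := reaches_insert A (hcols v List.mem_cons_self) (h.bitsLE hP)
      (cols.map encodeColumn).flatten
    refine (hfirst.trans hreach).mono (le_of_eq ?_)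
    simp only [List.map_cons, List.flatten_cons, List.length_append, List.length_cons]
    ring

theorem bitsLE_encodeColumn (v : Fin m → ℤ) : BitsLE (encodeColumn v).length v := by
  intro i
  have hentry : (v i).natAbs.bits.length ≤ (encodeEntry (v i)).length := by
    simp [encodeEntry]
    omega
  have hsub : (encodeEntry (v i)).Sublist (List.ofFn fun i => encodeEntry (v i)).flatten :=
    List.sublist_flatten_of_mem (List.mem_ofFn.2 ⟨i, rfl⟩)
  have := hsub.length_le
  simp only [encodeColumn, List.length_append]
  omega

end ColumnMachine

/-! ### The decision procedure -/

open ColumnMachine in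
theorem theorem4 (m k : ℕ) :
    DecidableInPolyTime (encodeMatrix (m := m)) (fun A => HasAffineTUDimension A.2 k) := by
  obtain ⟨D, hD, M, hM⟩ :=
    (isBinaryRecognizable_hasAffineTUDimension m (3 ^ (m + k)) k).exists_automaton
  have := Fintype.ofFinite D
  have := Fintype.ofFinite MatrixSymbol
  -- The summands account for reading, for comparing and restoring at each of at most `ℓ` columns,
  -- and for the final run.
  refine (machine M).decidableInPolyTime
    (Polynomial.X + Polynomial.X * (2 * Polynomial.X + 2) + (2 * Polynomial.X + 2)) fun A => ?_
  let cols : List (Fin m → ℤ) := List.ofFn fun j => A.2.col j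
  have hcols : encodeMatrix A = (cols.map encodeColumn).flatten := by
    rw [List.map_ofFn]
    rfl
  set ℓ := (encodeMatrix A).length with hℓ
  have hbits : ∀ v ∈ cols, BitsLE ℓ v := fun v hv i => by
    refine (bitsLE_encodeColumn v i).trans ?_
    rw [hℓ, hcols]
    exact (List.sublist_flatten_of_mem (List.mem_map_of_mem hv)).length_le
  -- Every column contributes at least its end marker, even when `m = 0`.
  have hlength : cols.length ≤ ℓ := by
    have : ∀ l : List (Fin m → ℤ), l.length ≤ (l.map encodeColumn).flatten.length := by
      intro l
      induction l with
      | nil => simp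
      | cons v l ih =>
        simp only [List.map_cons, List.flatten_cons, List.length_append, List.length_cons,
          encodeColumn] at ih ⊢
        simp only [List.length_nil]
        omega
    rw [hℓ, hcols]
    exact this cols
  obtain ⟨T, hT, hreach⟩ := reaches_columns M (T := ⟨0, ∅, false⟩) (P := ∅) cols
    ⟨by simp, by simp, by simp, by simp, by simp⟩ (by simp) hbits
  rw [Finset.union_empty] at hT
  obtain ⟨q, b, hend, haction, hb⟩ := reaches_end M (T := T)
    (hT.bitsLE fun v hv => hbits v (by simpa using hv))
  refine ⟨q, b, ((hreach.trans hend).mono ?_).congr ?_ rfl, haction, ?_⟩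
  · rw [← hcols, ← hℓ]
    simp only [Polynomial.eval_add, Polynomial.eval_mul, Polynomial.eval_X, Polynomial.eval_ofNat]
    gcongr
  · rw [← hcols]
    refine StackConfig.ext ?_ rfl (funext fun x => ?_)
    · refine congrArg (fun n => ((.read 0, n, ∅, false) : Control m (3 ^ (m + k)) D)) ?_
      funext ⟨s, i⟩
      cases s <;> simp [withCurrent]
    · rcases x with ⟨_ | _, _ | j, i⟩ <;> simp [ready, stored, banks, withCurrent]
  rw [hb, hM, Set.mem_ofPred_eq]
  cases ho : T.overflow
  -- Without overflow, the table and `A` have the same nonzero columns.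
  · simp only [true_and]
    refine (HasAffineTUDimension.congr_columns (fun j => ?_) fun j => ?_).symm
    · by_cases hj : j ∈ T.filled
      · right
        obtain ⟨j', hj'⟩ := List.mem_ofFn.1 (List.mem_toFinset.1 (hT.slot_mem j hj))
        exact ⟨j', fun i => (congrFun hj' i).symm⟩
      · left
        intro i
        simp [hT.slot_eq_zero j hj]
    · have hmem : A.2.col j ∈ cols.toFinset := List.mem_toFinset.2 (List.mem_ofFn.2 ⟨j, rfl⟩)
      exact (hT.exists_slot ho _ hmem).imp (fun h i => congrFun h i)
        fun ⟨j', h⟩ => ⟨j', fun i => congrFun h i⟩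
  · simp only [Bool.true_eq_false, false_and, false_iff]
    -- Overflow means more than `3 ^ (m + k)` distinct columns, which excludes a decomposition with
    -- `k` rows.
    intro hdim
    have hle := (hasAffineTUDimension_iff.1 hdim).1.card_columns_le
    have himage : cols.toFinset = Finset.univ.image fun j => A.2.col j := by
      ext v
      simp [cols]
    have hlt := hT.lt_card ho
    rw [himage] at hlt
    exact absurd hle (not_le.2 (by convert hlt))
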